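/- Let $K,M\ge 0$ be integers, $h_k\in\mathbb C^M$, $\sigma_k>0$, $\bar\gamma_k>0$ for $k=1,\dots,K$, and $\bar C_m,\bar P_m\in\mathbb R$ for $m=1,\dots,M$ (channel vectors, noise standard deviations, SINR targets, fronthaul capacities and per-antenna power budgets). Let $E_m$ be the $M\times M$ matrix whose only nonzero entry is a one in position $(m,m)$, and for an $M\times M$ matrix $Q$ let $Q_{[m]}=\begin{bmatrix}0&0\\0&Q^{(m:M,m:M)}\end{bmatrix}$ be the $M\times M$ matrix obtained from $Q$ by replacing all entries outside the rows and columns $m,\dots,M$ by zero. Consider the QCQP $$\begin{aligned}\min_{v_1,\dots,v_K\in\mathbb C^M,\ Q\succeq 0}\quad&\sum_{k}\|v_k\|^2+\operatorname{tr}(Q)\\ \text{s.t.}\quad&\tfrac{\bar\gamma_k+1}{\bar\gamma_k}|v_k^{H}h_k|^2-\sum_{j}|v_j^{H}h_k|^2-h_k^{H}Qh_k-\sigma_k^2\ge 0\quad\forall k,\\&2^{\bar C_m}Q_{[m]}-\Big(\sum_k|v_{k,m}|^2+Q^{(m,m)}\Big)E_m\succeq 0\quad\forall m,\\&\sum_k|v_{k,m}|^2+Q^{(m,m)}\le\bar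 P_m\quad\forall m,\end{aligned}$$ and its semidefinite relaxation (SDR) $$\begin{aligned}\min_{V_1,\dots,V_K\succeq 0,\ Q\succeq 0}\quad&\sum_{k}\operatorname{tr}(V_k)+\operatorname{tr}(Q)\\ \text{s.t.}\quad&\tfrac{\bar\gamma_k+1}{\bar\gamma_k}\operatorname{tr}(V_kh_kh_k^{H})-\sum_{j}\operatorname{tr}(V_jh_kh_k^{H})-\operatorname{tr}(Qh_kh_k^{H})-\sigma_k^2\ge 0\quad\forall k,\\&2^{\bar C_m}Q_{[m]}-\Big(\sum_kV_k^{(m,m)}+Q^{(m,m)}\Big)E_m\succeq 0\quad\forall m,\\&\sum_kV_k^{(m,m)}+Q^{(m,m)}\le\bar P_m\quad\forall m,\end{aligned}$$ where all matrices are complex Hermitian of size $M\times M$. Suppose that the SDR is strictly feasible: there are $V_k\succ0$ and $Q\succ0$ satisfying all its inequality constraints strictly, where the $m$-th matrix inequality, whose rows and columns $1,\dots,m-1$ vanish identically, is strict if its block of rows and columns $m,\dots,M$ is positive definite. Then every optimal solution $(\{V_k^*\},Q^*)$ of the SDR satisfies $\operatorname{rank}(V_k^*)=1$ for all $k$. Hence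 the SDR is tight and equivalent to the QCQP, that is: both problems attain their minima and the two minimum values are equal; every optimal solution $(\{V_k^*\},Q^*)$ of the SDR has the form $V_k^*=v_k^*(v_k^*)^{H}$ for all $k$, with $(\{v_k^*\},Q^*)$ optimal for the QCQP; and $(\{v_k\},Q)$ is optimal for the QCQP if and only if $(\{v_kv_k^{H}\},Q)$ is optimal for the SDR. -/

import Mathlib

open scoped ComplexOrder

noncomputable section

/-- Data of a cooperative cellular network with `K` single-antenna users and `M` single-antenna
base stations. -/
structure Network (K M : ℕ) where
  /-- channel vector of each user -/
  h : Fin K → EuclideanSpace ℂ (Fin M)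
  /-- standard deviation of the noise at each user (the noise power is `σ k ^ 2`) -/
  σ : Fin K → ℝ
  /-- SINR target of each user -/
  γ : Fin K → ℝ
  /-- fronthaul capacity of each base station -/
  C : Fin M → ℝ
  /-- power budget of each antenna -/
  P : Fin M → ℝ

/-- The rank-one matrix `x xᴴ`. -/
def outer {M : ℕ} (x : EuclideanSpace ℂ (Fin M)) : Matrix (Fin M) (Fin M) ℂ :=
  Matrix.vecMulVec x.ofLp (star x.ofLp)

/-- The `M × M` matrix whose block of rows and columns with index at least `m` is the one of `Q`,
all other entries being zero. -/
def tailBlock {M : ℕ} (Q : Matrix (Fin M) (Fin M) ℂ) (m : Fin M) : Matrix (Fin M) (Fin M) ℂ :=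
  Matrix.of fun i j => if m ≤ i ∧ m ≤ j then Q i j else 0

/-- The matrix `2 ^ c • [0, 0; 0, Q^(m:M, m:M)] - p • E_m` of a fronthaul rate constraint. -/
def fronthaulMatrix {M : ℕ} (Q : Matrix (Fin M) (Fin M) ℂ) (m : Fin M) (c p : ℝ) :
    Matrix (Fin M) (Fin M) ℂ :=
  ((2 : ℝ) ^ c) • tailBlock Q m - p • Matrix.single m m (1 : ℂ)

namespace Network

variable {K M : ℕ} (N : Network K M)

/-! The problem in the beamforming vectors (a nonconvex QCQP). -/

/-- Transmit power of antenna `m`. -/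
def qcqpPower (v : Fin K → EuclideanSpace ℂ (Fin M)) (Q : Matrix (Fin M) (Fin M) ℂ) (m : Fin M) :
    ℝ :=
  ∑ k, ‖v k m‖ ^ 2 + (Q m m).re

/-- Left-hand side of the SINR constraint of user `k`. -/
def qcqpSINR (v : Fin K → EuclideanSpace ℂ (Fin M)) (Q : Matrix (Fin M) (Fin M) ℂ) (k : Fin K) :
    ℝ :=
  (N.γ k + 1) / N.γ k * ‖inner ℂ (v k) (N.h k)‖ ^ 2 - ∑ j, ‖inner ℂ (v j) (N.h k)‖ ^ 2
    - (star (N.h k).ofLp ⬝ᵥ Matrix.mulVec Q (N.h k).ofLp).re - N.σ k ^ 2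

/-- Objective of the QCQP: the total transmit power. -/
def qcqpObjective (v : Fin K → EuclideanSpace ℂ (Fin M)) (Q : Matrix (Fin M) (Fin M) ℂ) : ℝ :=
  ∑ k, ‖v k‖ ^ 2 + Q.trace.re

/-- Feasibility for the QCQP. -/
structure QCQPFeasible (v : Fin K → EuclideanSpace ℂ (Fin M)) (Q : Matrix (Fin M) (Fin M) ℂ) :
    Prop where
  posSemidef : Q.PosSemidef
  sinr : ∀ k, 0 ≤ N.qcqpSINR v Q k
  fronthaul : ∀ m, (fronthaulMatrix Q m (N.C m) (qcqpPower v Q m)).PosSemidef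
  power : ∀ m, qcqpPower v Q m ≤ N.P m

/-- Global optimality for the QCQP. -/
def QCQPOptimal (v : Fin K → EuclideanSpace ℂ (Fin M)) (Q : Matrix (Fin M) (Fin M) ℂ) : Prop :=
  N.QCQPFeasible v Q ∧
    ∀ v' Q', N.QCQPFeasible v' Q' → qcqpObjective v Q ≤ qcqpObjective v' Q'

/-- The set of objective values of feasible points of the QCQP. -/
def qcqpValues : Set ℝ := {r | ∃ v Q, N.QCQPFeasible v Q ∧ qcqpObjective v Q = r}

/-! The semidefinite relaxation. The quantities whose real part is taken below are real on
Hermitian matrices. -/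

/-- Transmit power of antenna `m`. -/
def sdrPower (V : Fin K → Matrix (Fin M) (Fin M) ℂ) (Q : Matrix (Fin M) (Fin M) ℂ) (m : Fin M) :
    ℝ :=
  ∑ k, (V k m m).re + (Q m m).re

/-- Left-hand side of the SINR constraint of user `k`. -/
def sdrSINR (V : Fin K → Matrix (Fin M) (Fin M) ℂ) (Q : Matrix (Fin M) (Fin M) ℂ) (k : Fin K) :
    ℝ :=
  (N.γ k + 1) / N.γ k * (V k * outer (N.h k)).trace.re - ∑ j, (V j * outer (N.h k)).trace.re
    - (Q * outer (N.h k)).trace.re - N.σ k ^ 2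

/-- Objective of the relaxation. -/
def sdrObjective (V : Fin K → Matrix (Fin M) (Fin M) ℂ) (Q : Matrix (Fin M) (Fin M) ℂ) : ℝ :=
  ∑ k, (V k).trace.re + Q.trace.re

/-- Feasibility for the relaxation. -/
structure SDRFeasible (V : Fin K → Matrix (Fin M) (Fin M) ℂ) (Q : Matrix (Fin M) (Fin M) ℂ) :
    Prop where
  posSemidef_V : ∀ k, (V k).PosSemidef
  posSemidef_Q : Q.PosSemidef
  sinr : ∀ k, 0 ≤ N.sdrSINR V Q k
  fronthaul : ∀ m, (fronthaulMatrix Q m (N.C m) (sdrPower V Q m)).PosSemidef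
  power : ∀ m, sdrPower V Q m ≤ N.P m

/-- Strict feasibility (Slater's condition) for the relaxation: some point satisfies all
constraints strictly. The rows and columns with index less than `m` of the `m`-th fronthaul matrix
are identically zero, so that constraint is a linear matrix inequality on the block of indices at
least `m`, and strictness means that this block is positive definite. -/
def SDRStrictlyFeasible : Prop :=
  ∃ (V : Fin K → Matrix (Fin M) (Fin M) ℂ) (Q : Matrix (Fin M) (Fin M) ℂ),
    (∀ k, (V k).PosDef) ∧ Q.PosDef ∧
    (∀ k, 0 < N.sdrSINR V Q k) ∧
    (∀ m, ((fronthaulMatrix Q m (N.C m) (sdrPower V Q m)).submatrix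
      (Subtype.val : {i : Fin M // m ≤ i} → Fin M)
      (Subtype.val : {i : Fin M // m ≤ i} → Fin M)).PosDef) ∧
    (∀ m, sdrPower V Q m < N.P m)

/-- Global optimality for the relaxation. -/
def SDROptimal (V : Fin K → Matrix (Fin M) (Fin M) ℂ) (Q : Matrix (Fin M) (Fin M) ℂ) : Prop :=
  N.SDRFeasible V Q ∧
    ∀ V' Q', N.SDRFeasible V' Q' → sdrObjective V Q ≤ sdrObjective V' Q'

/-- The set of objective values of feasible points of the relaxation. -/
def sdrValues : Set ℝ := {r | ∃ V Q, N.SDRFeasible V Q ∧ sdrObjective V Q = r}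

end Network

end

/-! Let $(V,Q)$ be feasible for the relaxation. Since the noise power is positive,
$a_k=h_k^HV_kh_k>0$, so $v_k=a_k^{-1/2}V_kh_k$ is defined. Then $V_k-v_kv_k^H\succeq 0$, while
$|v_k^Hh_k|^2=a_k$ (`Matrix.PosSemidef.exists_outer_sub`). Replacing each $V_k$ by $v_kv_k^H$ with
$Q$ fixed keeps the useful signals, does not increase interference or antenna powers, and so
preserves feasibility. The objective does not increase, and stays equal only if every $V_k=v_kv_k^H$
(`SDRFeasible.exists_outer`). Hence optimal points are rank-one, and the two problems share their
minimum.

The minimum exists because sublevel sets are compact (`isCompact_sdrFeasible_sublevel`); strict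
feasibility serves to supply a feasible point. -/

open Matrix

/-! ### Rank-one, positive semidefinite and fronthaul matrices. -/

section Matrices

variable {M : ℕ}

lemma outer_apply (x : EuclideanSpace ℂ (Fin M)) (i j : Fin M) :
    outer x i j = x i * star (x j) := rfl

lemma outer_posSemidef (x : EuclideanSpace ℂ (Fin M)) : (outer x).PosSemidef :=
  posSemidef_vecMulVec_self_star _

lemma trace_mul_outer (V : Matrix (Fin M) (Fin M) ℂ) (x : EuclideanSpace ℂ (Fin M)) :
    (V * outer x).trace = star x.ofLp ⬝ᵥ V *ᵥ x.ofLp := by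
  rw [outer, mul_vecMulVec, trace_vecMulVec, dotProduct_comm]

lemma trace_outer_mul_outer (x y : EuclideanSpace ℂ (Fin M)) :
    (outer x * outer y).trace.re = ‖inner ℂ x y‖ ^ 2 := by
  have h1 : inner ℂ x y = y.ofLp ⬝ᵥ star x.ofLp := rfl
  have h2 : star y.ofLp ⬝ᵥ x.ofLp = star (inner ℂ x y) := by
    rw [h1, star_dotProduct, dotProduct_comm]
  rw [trace_mul_outer, outer, vecMulVec_mulVec, dotProduct_smul, h2, dotProduct_comm, ← h1]
  change (star (inner ℂ x y) * inner ℂ x y).re = _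
  rw [mul_comm, RCLike.star_def, Complex.mul_conj, Complex.normSq_eq_norm_sq, Complex.ofReal_re]

lemma outer_apply_self_re (x : EuclideanSpace ℂ (Fin M)) (i : Fin M) :
    (outer x i i).re = ‖x i‖ ^ 2 := by
  rw [outer_apply, RCLike.star_def, Complex.mul_conj, Complex.normSq_eq_norm_sq, Complex.ofReal_re]

lemma trace_outer_re (x : EuclideanSpace ℂ (Fin M)) : (outer x).trace.re = ‖x‖ ^ 2 := by
  simp [EuclideanSpace.norm_sq_eq, Matrix.trace, outer_apply_self_re]

lemma Matrix.PosSemidef.trace_mul_outer_nonneg {V : Matrix (Fin M) (Fin M) ℂ}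
    (hV : V.PosSemidef) (x : EuclideanSpace ℂ (Fin M)) : 0 ≤ (V * outer x).trace := by
  rw [trace_mul_outer]
  exact hV.dotProduct_mulVec_nonneg _

lemma outer_mul_mul_outer (V : Matrix (Fin M) (Fin M) ℂ) (x : EuclideanSpace ℂ (Fin M)) :
    outer x * V * outer x = (V * outer x).trace • outer x := by
  rw [trace_mul_outer, outer, vecMulVec_mul, vecMulVec_mul_vecMulVec, ← dotProduct_mulVec]
  ext i j
  simp [vecMulVec_apply]
  ring

lemma rank_outer_of_ne_zero {x : EuclideanSpace ℂ (Fin M)} (hx : outer x ≠ 0) :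
    (outer x).rank = 1 := by
  refine le_antisymm (rank_vecMulVec_le _ _) (Nat.one_le_iff_ne_zero.mpr fun h => hx ?_)
  rw [rank, Submodule.finrank_eq_zero, LinearMap.range_eq_bot] at h
  exact (toLin' (R := ℂ)).injective (by rw [toLin'_apply', h, map_zero])

/-- A positive semidefinite matrix dominates a rank-one matrix that gives the same signal
power along a prescribed channel. -/
lemma Matrix.PosSemidef.exists_outer_sub {V : Matrix (Fin M) (Fin M) ℂ} (hV : V.PosSemidef)
    {x : EuclideanSpace ℂ (Fin M)} (hx : 0 < (V * outer x).trace.re) :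
    ∃ v, (V - outer v).PosSemidef ∧ (outer v * outer x).trace = (V * outer x).trace := by
  set a : ℝ := (V * outer x).trace.re with ha
  have ha' : (V * outer x).trace = (a : ℂ) := by
    apply Complex.ext
    · rfl
    · simpa using (Complex.nonneg_iff.mp (hV.trace_mul_outer_nonneg x)).2.symm
  have ha0 : (a : ℂ) ≠ 0 := by exact_mod_cast hx.ne'
  have hs : ((Real.sqrt a : ℝ) : ℂ)⁻¹ * ((Real.sqrt a : ℝ) : ℂ)⁻¹ = (a : ℂ)⁻¹ := by
    rw [← mul_inv, ← Complex.ofReal_mul, Real.mul_self_sqrt hx.le]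
  have hH : (outer x)ᴴ = outer x := (outer_posSemidef x).1
  have hxx : outer x * V * outer x = (a : ℂ) • outer x := by rw [outer_mul_mul_outer, ha']
  -- The scaling $a^{-1/2}$ gives $vv^H=a^{-1}VXV$ with $X=xx^H$.
  set v : EuclideanSpace ℂ (Fin M) :=
    WithLp.toLp 2 (((Real.sqrt a : ℝ) : ℂ)⁻¹ • V *ᵥ x.ofLp) with hv
  have hout : outer v = (a : ℂ)⁻¹ • (V * outer x * V) := by
    have hstar : star (V *ᵥ x.ofLp) = star x.ofLp ᵥ* V := by
      rw [star_mulVec, hV.1.eq]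
    rw [outer, hv, outer, mul_vecMulVec, vecMulVec_mul, ← hstar, ← hs]
    ext i j
    simp [vecMulVec_apply]
    ring
  refine ⟨v, ?_, ?_⟩
  -- With $B=1-a^{-1}XV$, the identity $XVX=aX$ collapses $B^HVB$ to $V-a^{-1}VXV=V-vv^H$.
  · have := hV.conjTranspose_mul_mul_same (1 - (a : ℂ)⁻¹ • (outer x * V))
    convert this using 1
    have hc : (1 - (a : ℂ)⁻¹ • (outer x * V))ᴴ = 1 - (a : ℂ)⁻¹ • (V * outer x) := by
      simp [conjTranspose_sub, conjTranspose_smul, conjTranspose_mul, hV.1.eq, hH]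
    have h4 : V * outer x * V * (outer x * V) = (a : ℂ) • (V * outer x * V) := by
      calc V * outer x * V * (outer x * V) = V * (outer x * V * outer x) * V := by
            simp only [Matrix.mul_assoc]
        _ = _ := by rw [hxx]; simp
    rw [hc, hout, Matrix.sub_mul, Matrix.one_mul, Matrix.mul_sub, Matrix.mul_one, Matrix.sub_mul]
    simp only [Matrix.mul_smul, Matrix.smul_mul, smul_smul, ← Matrix.mul_assoc]
    simp only [Matrix.mul_assoc] at h4 ⊢
    rw [h4, smul_smul, inv_mul_cancel_right₀ ha0]
    abel
  · rw [hout, Matrix.smul_mul, Matrix.mul_assoc, Matrix.mul_assoc, ← Matrix.mul_assoc (outer x),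
      hxx, Matrix.mul_smul, smul_smul, inv_mul_cancel₀ ha0, one_smul]

lemma Matrix.PosSemidef.diag_re_le_trace_re {V : Matrix (Fin M) (Fin M) ℂ} (hV : V.PosSemidef)
    (i : Fin M) : (V i i).re ≤ V.trace.re := by
  rw [Matrix.trace, Complex.re_sum]
  exact Finset.single_le_sum (f := fun i => (V.diag i).re)
    (fun j _ => (Complex.nonneg_iff.mp (hV.diag_nonneg (i := j))).1) (Finset.mem_univ i)

lemma Matrix.PosSemidef.trace_re_nonneg {V : Matrix (Fin M) (Fin M) ℂ} (hV : V.PosSemidef) :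
    0 ≤ V.trace.re :=
  (Complex.nonneg_iff.mp hV.trace_nonneg).1

/-- The $2\times2$ minor on $i,j$ gives $|V_{ij}|^2\le V_{ii}V_{jj}$, and each diagonal entry is at
most the trace. This bounds the sublevel sets of the objective. -/
lemma Matrix.PosSemidef.norm_apply_le_trace_re {V : Matrix (Fin M) (Fin M) ℂ} (hV : V.PosSemidef)
    (i j : Fin M) : ‖V i j‖ ≤ V.trace.re := by
  have hdet := (hV.submatrix ![i, j]).det_nonneg
  have hij : V j i = star (V i j) := (hV.1.apply i j).symm ▸ (by simp)
  obtain ⟨hi, hi'⟩ := Complex.nonneg_iff.mp (hV.diag_nonneg (i := i))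
  obtain ⟨hj, hj'⟩ := Complex.nonneg_iff.mp (hV.diag_nonneg (i := j))
  rw [det_fin_two] at hdet
  simp only [submatrix_apply, cons_val_zero, cons_val_one, hij] at hdet
  have h1 := (Complex.nonneg_iff.mp hdet).1
  have h2 : ‖V i j‖ ^ 2 = (V i j).re * (V i j).re + (V i j).im * (V i j).im := by
    rw [← Complex.normSq_eq_norm_sq, Complex.normSq_apply]
  simp [← hi', ← hj'] at h1
  have h3 : (V i i).re * (V j j).re ≤ V.trace.re * V.trace.re :=
    mul_le_mul (hV.diag_re_le_trace_re i) (hV.diag_re_le_trace_re j) hj hV.trace_re_nonneg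
  refine abs_le_of_sq_le_sq' ?_ hV.trace_re_nonneg |>.2
  nlinarith

lemma isClosed_setOf_posSemidef : IsClosed {V : Matrix (Fin M) (Fin M) ℂ | V.PosSemidef} := by
  simp only [posSemidef_iff_dotProduct_mulVec, Set.ofPred_and, Set.ofPred_forall, IsHermitian]
  refine (isClosed_eq (by fun_prop) (by fun_prop)).inter (isClosed_iInter fun x => ?_)
  exact isClosed_le (by fun_prop) (by fun_prop)

lemma single_one_posSemidef (m : Fin M) : (Matrix.single m m (1 : ℂ)).PosSemidef := by
  rw [← diagonal_single]
  exact PosSemidef.diagonal (Pi.single_nonneg.mpr zero_le_one)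

/-- Lowering the power at fixed $Q$ adds a nonnegative multiple of $E_m$. -/
lemma fronthaulMatrix_posSemidef_anti {Q : Matrix (Fin M) (Fin M) ℂ} {m : Fin M} {c p p' : ℝ}
    (hp : p' ≤ p) (h : (fronthaulMatrix Q m c p).PosSemidef) :
    (fronthaulMatrix Q m c p').PosSemidef := by
  have h' : fronthaulMatrix Q m c p' =
      fronthaulMatrix Q m c p + (p - p') • Matrix.single m m (1 : ℂ) := by
    simp only [fronthaulMatrix, sub_smul]
    abel
  rw [h']
  exact h.add ((single_one_posSemidef m).smul (sub_nonneg.mpr hp))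

lemma fronthaulMatrix_apply_eq_zero (Q : Matrix (Fin M) (Fin M) ℂ) (m : Fin M) (c p : ℝ)
    {i j : Fin M} (h : ¬(m ≤ i ∧ m ≤ j)) : fronthaulMatrix Q m c p i j = 0 := by
  have h' : ¬(m = i ∧ m = j) := fun h' => h ⟨h'.1.le, h'.2.le⟩
  simp [fronthaulMatrix, tailBlock, h, h']

/-- $F=R^HSR$, where $S$ is the block and $R$ consists of the rows of the identity indexed by $s$.
This turns strictness on a block into the full fronthaul constraint. -/
lemma posSemidef_of_submatrix_subtype {F : Matrix (Fin M) (Fin M) ℂ} {s : Fin M → Prop}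
    [DecidablePred s] (h0 : ∀ i j, ¬(s i ∧ s j) → F i j = 0)
    (h : (F.submatrix (Subtype.val : {i // s i} → Fin M) Subtype.val).PosSemidef) :
    F.PosSemidef := by
  have := h.conjTranspose_mul_mul_same ((1 : Matrix (Fin M) (Fin M) ℂ).submatrix Subtype.val id)
  convert this using 1
  ext i j
  simp only [Matrix.mul_apply, conjTranspose_apply, submatrix_apply, id, one_apply]
  by_cases hij : s i ∧ s j
  · rw [Finset.sum_eq_single ⟨j, hij.2⟩, Finset.sum_eq_single ⟨i, hij.1⟩]
    · simp
    · rintro b - hb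
      have : b.1 ≠ i := fun h => hb (Subtype.ext h)
      simp [this]
    · simp
    · rintro b - hb
      have : b.1 ≠ j := fun h => hb (Subtype.ext h)
      simp [this]
    · simp
  · rw [h0 i j hij]
    refine (Finset.sum_eq_zero fun b _ => ?_).symm
    by_cases hb : b.1 = j
    · rw [Finset.sum_eq_zero, zero_mul]
      intro a _
      have : a.1 ≠ i := fun ha => hij ⟨ha ▸ a.2, hb ▸ b.2⟩
      simp [this]
    · simp [hb]

end Matrices

/-! ### The rank-one lift and domination by rank-one points. -/

namespace Network

variable {K M : ℕ} (N : Network K M)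

lemma sdrPower_outer (v : Fin K → EuclideanSpace ℂ (Fin M)) (Q : Matrix (Fin M) (Fin M) ℂ) :
    sdrPower (fun k => outer (v k)) Q = qcqpPower v Q := by
  funext m
  simp [sdrPower, qcqpPower, outer_apply_self_re]

lemma sdrObjective_outer (v : Fin K → EuclideanSpace ℂ (Fin M)) (Q : Matrix (Fin M) (Fin M) ℂ) :
    sdrObjective (fun k => outer (v k)) Q = qcqpObjective v Q := by
  simp [sdrObjective, qcqpObjective, trace_outer_re]

lemma sdrSINR_outer (v : Fin K → EuclideanSpace ℂ (Fin M)) (Q : Matrix (Fin M) (Fin M) ℂ) :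
    N.sdrSINR (fun k => outer (v k)) Q = N.qcqpSINR v Q := by
  funext k
  simp only [sdrSINR, qcqpSINR, trace_outer_mul_outer, trace_mul_outer Q]

lemma sdrFeasible_outer_iff (v : Fin K → EuclideanSpace ℂ (Fin M))
    (Q : Matrix (Fin M) (Fin M) ℂ) :
    N.SDRFeasible (fun k => outer (v k)) Q ↔ N.QCQPFeasible v Q := by
  constructor
  · rintro ⟨-, h2, h3, h4, h5⟩
    rw [sdrPower_outer] at h4 h5
    rw [sdrSINR_outer] at h3
    exact ⟨h2, h3, h4, h5⟩
  · rintro ⟨h2, h3, h4, h5⟩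
    rw [← sdrPower_outer] at h4 h5
    rw [← sdrSINR_outer] at h3
    exact ⟨fun k => outer_posSemidef _, h2, h3, h4, h5⟩

/-- Cancelling user $k$'s own term, $(\gamma+1)/\gamma-1=1/\gamma$, leaves a form monotone in each
matrix: increasing in $V_k$, decreasing in the other $V_j$. -/
lemma sdrSINR_eq {k : Fin K} (hγ : 0 < N.γ k) (V : Fin K → Matrix (Fin M) (Fin M) ℂ)
    (Q : Matrix (Fin M) (Fin M) ℂ) :
    N.sdrSINR V Q k = (N.γ k)⁻¹ * (V k * outer (N.h k)).trace.re
      - ∑ j ∈ Finset.univ.erase k, (V j * outer (N.h k)).trace.re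
      - (Q * outer (N.h k)).trace.re - N.σ k ^ 2 := by
  rw [sdrSINR, ← Finset.add_sum_erase _ _ (Finset.mem_univ k)]
  field_simp
  ring

variable {N}

/-- The useful signal must outweigh nonnegative interference plus positive noise. This permits
division by the signal power and rules out $V_k=0$. -/
lemma SDRFeasible.signal_pos (hσ : ∀ k, 0 < N.σ k) (hγ : ∀ k, 0 < N.γ k)
    {V : Fin K → Matrix (Fin M) (Fin M) ℂ} {Q : Matrix (Fin M) (Fin M) ℂ}
    (h : N.SDRFeasible V Q) (k : Fin K) : 0 < (V k * outer (N.h k)).trace.re := by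
  have h1 := h.sinr k
  rw [sdrSINR_eq N (hγ k)] at h1
  have h2 : 0 ≤ ∑ j ∈ Finset.univ.erase k, (V j * outer (N.h k)).trace.re :=
    Finset.sum_nonneg fun j _ =>
      (Complex.nonneg_iff.mp ((h.posSemidef_V j).trace_mul_outer_nonneg _)).1
  have h3 := (Complex.nonneg_iff.mp (h.posSemidef_Q.trace_mul_outer_nonneg (N.h k))).1
  have h4 : 0 < N.σ k ^ 2 := pow_pos (hσ k) 2
  have h5 : 0 < (N.γ k)⁻¹ * (V k * outer (N.h k)).trace.re := by linarith
  exact pos_of_mul_pos_right h5 (inv_pos.mpr (hγ k)).le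

/-- Every feasible point of the relaxation is dominated by a rank-one feasible point, strictly
so unless it has rank one itself. -/
lemma SDRFeasible.exists_outer (hσ : ∀ k, 0 < N.σ k) (hγ : ∀ k, 0 < N.γ k)
    {V : Fin K → Matrix (Fin M) (Fin M) ℂ} {Q : Matrix (Fin M) (Fin M) ℂ}
    (h : N.SDRFeasible V Q) :
    ∃ v, N.QCQPFeasible v Q ∧ qcqpObjective v Q ≤ sdrObjective V Q ∧
      (qcqpObjective v Q = sdrObjective V Q → ∀ k, V k = outer (v k)) := by
  choose v hv hv' using fun k => (h.posSemidef_V k).exists_outer_sub (h.signal_pos hσ hγ k)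
  have htr : ∀ k, (outer (v k)).trace.re ≤ (V k).trace.re := fun k => by
    have := (hv k).trace_re_nonneg
    rw [trace_sub, Complex.sub_re] at this
    linarith
  have hpow : ∀ m, sdrPower (fun k => outer (v k)) Q m ≤ sdrPower V Q m := fun m => by
    refine add_le_add_left (Finset.sum_le_sum fun k _ => ?_) _
    have := (Complex.nonneg_iff.mp ((hv k).diag_nonneg (i := m))).1
    rw [Matrix.sub_apply, Complex.sub_re] at this
    linarith
  refine ⟨v, (sdrFeasible_outer_iff N v Q).mp ⟨fun k => outer_posSemidef _, h.posSemidef_Q,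
    fun k => ?_, fun m => fronthaulMatrix_posSemidef_anti (hpow m) (h.fronthaul m),
    fun m => (hpow m).trans (h.power m)⟩, ?_, ?_⟩
  · have h1 := h.sinr k
    rw [sdrSINR_eq N (hγ k)] at h1 ⊢
    have h2 : ∑ j ∈ Finset.univ.erase k, (outer (v j) * outer (N.h k)).trace.re ≤
        ∑ j ∈ Finset.univ.erase k, (V j * outer (N.h k)).trace.re :=
      Finset.sum_le_sum fun j _ => by
        have := (Complex.nonneg_iff.mp ((hv j).trace_mul_outer_nonneg (N.h k))).1
        rw [Matrix.sub_mul, trace_sub, Complex.sub_re] at this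
        linarith
    rw [hv' k]
    linarith
  · rw [← sdrObjective_outer]
    exact add_le_add_left (Finset.sum_le_sum fun k _ => htr k) _
  · rw [← sdrObjective_outer]
    intro heq k
    have h1 := (Finset.sum_eq_sum_iff_of_le fun k _ => htr k).mp (add_right_cancel heq) k
      (Finset.mem_univ k)
    -- Equal objectives force equal traces term by term, and a positive semidefinite difference of
    -- trace zero vanishes.
    refine sub_eq_zero.mp ((hv k).trace_eq_zero_iff.mp (Complex.ext ?_ ?_))
    · rw [trace_sub, Complex.sub_re, h1, sub_self, Complex.zero_re]
    · exact (Complex.nonneg_iff.mp (hv k).trace_nonneg).2.symm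

lemma SDRStrictlyFeasible.exists_sdrFeasible (h : N.SDRStrictlyFeasible) :
    ∃ V Q, N.SDRFeasible V Q := by
  obtain ⟨V, Q, h1, h2, h3, h4, h5⟩ := h
  exact ⟨V, Q, fun k => (h1 k).posSemidef, h2.posSemidef, fun k => (h3 k).le,
    fun m => posSemidef_of_submatrix_subtype
      (fun _ _ hij => fronthaulMatrix_apply_eq_zero _ _ _ _ hij) (h4 m).posSemidef,
    fun m => (h5 m).le⟩

/-! ### Closedness of the feasible set and compactness of sublevel sets. -/

lemma continuous_sdrPower (m : Fin M) :
    Continuous fun x : (Fin K → Matrix (Fin M) (Fin M) ℂ) × Matrix (Fin M) (Fin M) ℂ =>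
      sdrPower x.1 x.2 m := by
  unfold sdrPower
  fun_prop

lemma continuous_sdrObjective :
    Continuous fun x : (Fin K → Matrix (Fin M) (Fin M) ℂ) × Matrix (Fin M) (Fin M) ℂ =>
      sdrObjective x.1 x.2 := by
  unfold sdrObjective Matrix.trace Matrix.diag
  fun_prop

variable (N)

lemma continuous_sdrSINR (k : Fin K) :
    Continuous fun x : (Fin K → Matrix (Fin M) (Fin M) ℂ) × Matrix (Fin M) (Fin M) ℂ =>
      N.sdrSINR x.1 x.2 k := by
  simp only [sdrSINR, trace_mul_outer]
  fun_prop

lemma continuous_fronthaulMatrix (m : Fin M) :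
    Continuous fun x : (Fin K → Matrix (Fin M) (Fin M) ℂ) × Matrix (Fin M) (Fin M) ℂ =>
      fronthaulMatrix x.2 m (N.C m) (sdrPower x.1 x.2 m) := by
  have h : Continuous fun x : (Fin K → Matrix (Fin M) (Fin M) ℂ) × Matrix (Fin M) (Fin M) ℂ =>
      tailBlock x.2 m := by
    refine continuous_matrix fun i j => ?_
    simp only [tailBlock, of_apply]
    split_ifs <;> fun_prop
  exact (h.const_smul ((2 : ℝ) ^ N.C m)).sub ((continuous_sdrPower m).smul continuous_const)

lemma isClosed_setOf_sdrFeasible :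
    IsClosed {x : (Fin K → Matrix (Fin M) (Fin M) ℂ) × Matrix (Fin M) (Fin M) ℂ |
      N.SDRFeasible x.1 x.2} := by
  have heq : {x : (Fin K → Matrix (Fin M) (Fin M) ℂ) × Matrix (Fin M) (Fin M) ℂ |
      N.SDRFeasible x.1 x.2} = {x | (∀ k, (x.1 k).PosSemidef) ∧ x.2.PosSemidef ∧
        (∀ k, 0 ≤ N.sdrSINR x.1 x.2 k) ∧
        (∀ m, (fronthaulMatrix x.2 m (N.C m) (sdrPower x.1 x.2 m)).PosSemidef) ∧
        ∀ m, sdrPower x.1 x.2 m ≤ N.P m} :=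
    Set.ext fun x => ⟨fun ⟨a, b, c, d, e⟩ => ⟨a, b, c, d, e⟩,
      fun ⟨a, b, c, d, e⟩ => ⟨a, b, c, d, e⟩⟩
  rw [heq]
  simp only [Set.ofPred_and, Set.ofPred_forall]
  refine (isClosed_iInter fun k => isClosed_setOf_posSemidef.preimage (by fun_prop)).inter <|
    (isClosed_setOf_posSemidef.preimage continuous_snd).inter <|
    (isClosed_iInter fun k => isClosed_le continuous_const (N.continuous_sdrSINR k)).inter <|
    (isClosed_iInter fun m =>
      isClosed_setOf_posSemidef.preimage (N.continuous_fronthaulMatrix m)).inter <|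
    isClosed_iInter fun m => isClosed_le (continuous_sdrPower m) continuous_const

lemma isCompact_sdrFeasible_sublevel (c : ℝ) :
    IsCompact {x : (Fin K → Matrix (Fin M) (Fin M) ℂ) × Matrix (Fin M) (Fin M) ℂ |
      N.SDRFeasible x.1 x.2 ∧ sdrObjective x.1 x.2 ≤ c} := by
  have hB : IsCompact {A : Matrix (Fin M) (Fin M) ℂ | ∀ i j, A i j ∈ Metric.closedBall 0 c} := by
    have h := isCompact_univ_pi fun _ : Fin M => isCompact_univ_pi fun _ : Fin M =>
      isCompact_closedBall (0 : ℂ) c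
    simp only [Set.pi, Set.mem_univ, true_imp_iff] at h
    exact h
  have hB' : IsCompact {V : Fin K → Matrix (Fin M) (Fin M) ℂ |
      ∀ k, V k ∈ {A : Matrix (Fin M) (Fin M) ℂ | ∀ i j, A i j ∈ Metric.closedBall 0 c}} := by
    have h := isCompact_univ_pi fun _ : Fin K => hB
    simp only [Set.pi, Set.mem_univ, true_imp_iff] at h
    exact h
  -- All traces are nonnegative, so an objective at most $c$ bounds each trace, hence each entry, by
  -- $c$.
  refine (hB'.prod hB).of_isClosed_subset
    (N.isClosed_setOf_sdrFeasible.inter (isClosed_le continuous_sdrObjective continuous_const)) ?_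
  rintro ⟨V, Q⟩ ⟨hf, hc⟩
  have hsum : ∀ k, (V k).trace.re ≤ ∑ k, (V k).trace.re := fun k =>
    Finset.single_le_sum (f := fun k => (V k).trace.re)
      (fun j _ => (hf.posSemidef_V j).trace_re_nonneg) (Finset.mem_univ k)
  have hsum0 : 0 ≤ ∑ k, (V k).trace.re :=
    Finset.sum_nonneg fun j _ => (hf.posSemidef_V j).trace_re_nonneg
  have hQ0 := hf.posSemidef_Q.trace_re_nonneg
  simp only [sdrObjective] at hc
  refine ⟨fun k i j => ?_, fun i j => ?_⟩ <;> rw [mem_closedBall_zero_iff]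
  · have := (hf.posSemidef_V k).norm_apply_le_trace_re i j
    linarith [hsum k]
  · have := hf.posSemidef_Q.norm_apply_le_trace_re i j
    simp only at this ⊢
    linarith

/-! ### Attainment and transfer of optimality. -/

variable {N}

/-- A minimizer over the sublevel set of one feasible point is global: points outside already have a
larger objective. -/
lemma exists_sdrOptimal (h : ∃ V Q, N.SDRFeasible V Q) : ∃ V Q, N.SDROptimal V Q := by
  obtain ⟨V₀, Q₀, h₀⟩ := h
  obtain ⟨⟨V, Q⟩, ⟨hf, hc⟩, hmin⟩ :=
    (N.isCompact_sdrFeasible_sublevel (sdrObjective V₀ Q₀)).exists_isMinOn ⟨(V₀, Q₀), h₀, le_rfl⟩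
      continuous_sdrObjective.continuousOn
  refine ⟨V, Q, hf, fun V' Q' h' => ?_⟩
  rcases le_total (sdrObjective V' Q') (sdrObjective V₀ Q₀) with hle | hle
  · exact hmin (show (V', Q') ∈ _ from ⟨h', hle⟩)
  · exact hc.trans hle

lemma SDROptimal.exists_outer (hσ : ∀ k, 0 < N.σ k) (hγ : ∀ k, 0 < N.γ k)
    {V : Fin K → Matrix (Fin M) (Fin M) ℂ} {Q : Matrix (Fin M) (Fin M) ℂ}
    (h : N.SDROptimal V Q) : ∃ v : Fin K → EuclideanSpace ℂ (Fin M), V = fun k => outer (v k) := by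
  obtain ⟨v, hv, hle, heq⟩ := h.1.exists_outer hσ hγ
  refine ⟨v, funext (heq (le_antisymm hle ?_))⟩
  rw [← sdrObjective_outer]
  exact h.2 _ _ ((sdrFeasible_outer_iff N v Q).mpr hv)

/-- Forwards, each competitor in the relaxation is dominated by a rank-one one; backwards, each QCQP
competitor lifts to the relaxation at the same cost. -/
lemma qcqpOptimal_iff_sdrOptimal_outer (hσ : ∀ k, 0 < N.σ k) (hγ : ∀ k, 0 < N.γ k)
    (v : Fin K → EuclideanSpace ℂ (Fin M)) (Q : Matrix (Fin M) (Fin M) ℂ) :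
    N.QCQPOptimal v Q ↔ N.SDROptimal (fun k => outer (v k)) Q := by
  rw [QCQPOptimal, SDROptimal, sdrFeasible_outer_iff, sdrObjective_outer]
  refine and_congr_right fun _ => ⟨fun h V' Q' h' => ?_, fun h v' Q' h' => ?_⟩
  · obtain ⟨v', hv', hle, -⟩ := h'.exists_outer hσ hγ
    exact (h v' Q' hv').trans hle
  · rw [← sdrObjective_outer v']
    exact h _ _ ((sdrFeasible_outer_iff N v' Q').mpr h')

end Network

open Network in
theorem theorem1 {K M : ℕ} (N : Network K M)
    (hσ : ∀ k, 0 < N.σ k) (hγ : ∀ k, 0 < N.γ k)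
    (hstrict : N.SDRStrictlyFeasible) :
    -- every optimal solution of the relaxation is rank-one
    (∀ V Q, N.SDROptimal V Q → ∀ k, (V k).rank = 1) ∧
    -- both problems attain their minima, and the minima agree
    (∃ p : ℝ, IsLeast N.sdrValues p ∧ IsLeast N.qcqpValues p) ∧
    -- every optimal solution of the relaxation comes from an optimal solution of the QCQP
    (∀ V Q, N.SDROptimal V Q → ∃ v, (∀ k, V k = outer (v k)) ∧ N.QCQPOptimal v Q) ∧
    -- a point is optimal for the QCQP iff its lift is optimal for the relaxation
    (∀ v Q, N.QCQPOptimal v Q ↔ N.SDROptimal (fun k => outer (v k)) Q) := by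
  refine ⟨fun V Q h k => ?_, ?_, fun V Q h => ?_, qcqpOptimal_iff_sdrOptimal_outer hσ hγ⟩
  · have hpos := h.1.signal_pos hσ hγ k
    obtain ⟨v, rfl⟩ := h.exists_outer hσ hγ
    -- Rank zero is excluded because the signal power is positive.
    refine rank_outer_of_ne_zero fun h0 => hpos.ne' ?_
    simp [h0]
  · obtain ⟨V, Q, h⟩ := exists_sdrOptimal hstrict.exists_sdrFeasible
    obtain ⟨v, rfl⟩ := h.exists_outer hσ hγ
    have hq := (qcqpOptimal_iff_sdrOptimal_outer hσ hγ v Q).mpr h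
    refine ⟨qcqpObjective v Q, ⟨⟨_, _, h.1, sdrObjective_outer v Q⟩, ?_⟩,
      ⟨⟨_, _, hq.1, rfl⟩, ?_⟩⟩
    · rintro _ ⟨V', Q', h', rfl⟩
      rw [← sdrObjective_outer]
      exact h.2 V' Q' h'
    · rintro _ ⟨v', Q', h', rfl⟩
      exact hq.2 v' Q' h'
  · obtain ⟨v, rfl⟩ := h.exists_outer hσ hγ
    exact ⟨v, fun _ => rfl, (qcqpOptimal_iff_sdrOptimal_outer hσ hγ v Q).mpr h⟩
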